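/- **Proposition 4.3 (perpetual loan with dividends delivered to the borrower).** Let $r>0$, $\delta>0$, $\sigma>0$, $K>0$ and $\gamma\in\mathbb R$ be constants, and let $W$ be a standard one-dimensional Brownian motion on a filtered probability space $(\Omega,\mathscr F,(\mathscr F_t)_{t\ge0},\mathbb P)$ (adapted, with increments after time $s$ independent of $\mathscr F_s$). For $S>0$ and $u\ge t\ge 0$ let $$S_u=S\exp\bigl((r-\delta-\tfrac12\sigma^2)(u-t)+\sigma(W_u-W_t)\bigr)$$ be the geometric Brownian motion $dS_u=(r-\delta)S_u\,du+\sigma S_u\,dW_u$ with $S_t=S$, and for $I\ge 0$ let $I_v=e^{r(v-t)}I+\int_t^v\delta e^{r(v-u)}S_u\,du$ be the accumulated dividends. For a maturity $T>0$ and $t\in[0,T]$ let $\mathcal T_{[t,T]}$ be the set of $(\mathscr F_s)$-stopping times with values in $[t,T]$. The value of the stock loan with principal $K$ and loan rate $\gamma$, the dividends always being delivered to the borrower, is $$V_3(S,I,t)=\sup_{v\in\mathcal T_{[t,T]}}\mathbb E\Bigl[e^{-r(v-t)}\bigl((S_v-Ke^{\gamma v})^++I_v\bigr)\Bigr],$$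 and $H(S,t)=V_3(S,I,t)-I$, which does not depend on $I$. Put $Q=(0,\infty)\times[0,T)$, let $$E_3=\{(S,t)\in Q: H(S,t)=S-Ke^{\gamma t}\}$$ be the redemption region, and let $S_3^*(t)=\inf\{S:(S,t)\in E_3\}$. Then: 1. (The perpetual stock loan is equivalent to the stock.) For all $S>0$ and $t\ge0$, $$\lim_{T\to\infty}H(S,t)=S .$$ 2. If $r<\gamma$, then for every $T>0$ the function $S_3^*:[0,T)\to(0,\infty)$ is the redemption boundary, that is, $E_3=\{(S,t)\in Q: S\ge S_3^*(t)\}$, and for every $t\ge 0$ $$\lim_{T\to\infty}S_3^*(t)=+\infty .$$ -/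

import Mathlib

open MeasureTheory ProbabilityTheory Filter Topology
open scoped NNReal ENNReal

namespace StockLoan

/-- `W` is a standard one-dimensional Brownian motion on the filtered probability space
`(Ω, ℱ, P)`: a Brownian motion, adapted to `ℱ`, whose increments after time `s` are independent
of `ℱ s`. -/
structure IsFilteredBrownian {Ω : Type*} {mΩ : MeasurableSpace Ω} (W : ℝ≥0 → Ω → ℝ)
    (ℱ : Filtration ℝ≥0 mΩ) (P : Measure Ω) : Prop where
  isBrownian : IsBrownianReal W P
  adapted : ∀ t, Measurable[ℱ t] (W t)
  indep : ∀ s t : ℝ≥0, s ≤ t →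
    Indep (MeasurableSpace.comap (fun ω => W t ω - W s ω) inferInstance) (ℱ s) P

/-- The constants of the model: riskless rate `r`, dividend yield `δ`, volatility `σ`,
principal `K` and loan interest rate `γ`. -/
structure Params where
  r : ℝ
  δ : ℝ
  σ : ℝ
  K : ℝ
  γ : ℝ

section

variable {Ω : Type*} {mΩ : MeasurableSpace Ω}

/-- The price at time `u ≥ t` of the stock that is worth `S` at time `t`: the geometric Brownian
motion `dS_u = (r - δ) S_u du + σ S_u dW_u`, `S_t = S`, in its explicit form. -/
noncomputable def stock (p : Params) (W : ℝ≥0 → Ω → ℝ) (S : ℝ) (t u : ℝ≥0) (ω : Ω) : ℝ :=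
  S * Real.exp ((p.r - p.δ - p.σ ^ 2 / 2) * ((u : ℝ) - t) + p.σ * (W u ω - W t ω))

/-- The accumulated dividends at time `v ≥ t` when they are worth `I` at time `t`:
`I_v = e^{r(v-t)} I + ∫_t^v δ e^{r(v-u)} S_u du`. -/
noncomputable def accDiv (p : Params) (W : ℝ≥0 → Ω → ℝ) (S I : ℝ) (t v : ℝ≥0) (ω : Ω) : ℝ :=
  Real.exp (p.r * ((v : ℝ) - t)) * I +
    ∫ u in (t : ℝ)..(v : ℝ),
      p.δ * Real.exp (p.r * ((v : ℝ) - u)) * stock p W S t u.toNNReal ω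

/-- The payoff of redeeming at time `v`, discounted to time `t`, when the dividends are always
delivered to the borrower: `e^{-r(v-t)} ((S_v - K e^{γv})^+ + I_v)`. -/
noncomputable def payoff (p : Params) (W : ℝ≥0 → Ω → ℝ) (S I : ℝ) (t v : ℝ≥0) (ω : Ω) : ℝ :=
  Real.exp (-p.r * ((v : ℝ) - t)) *
    (max (stock p W S t v ω - p.K * Real.exp (p.γ * v)) 0 + accDiv p W S I t v ω)

/-- The `ℱ`-stopping times with values in `[t, T]`. -/
def stoppingTimes (ℱ : Filtration ℝ≥0 mΩ) (t T : ℝ≥0) : Set (Ω → ℝ≥0) :=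
  {v | IsStoppingTime ℱ (fun ω => (v ω : WithTop ℝ≥0)) ∧ ∀ ω, t ≤ v ω ∧ v ω ≤ T}

/-- The value `V₃(S, I, t)` of the stock loan of maturity `T`: the supremum of the expected
discounted payoffs over all redeeming times. The payoff is nonnegative for `S, I ≥ 0`, so its
expectation is taken in `[0, ∞]`. -/
noncomputable def V3 (p : Params) (ℱ : Filtration ℝ≥0 mΩ) (W : ℝ≥0 → Ω → ℝ) (P : Measure Ω)
    (T : ℝ≥0) (S I : ℝ) (t : ℝ≥0) : ℝ≥0∞ :=
  ⨆ v ∈ stoppingTimes ℱ t T, ∫⁻ ω, ENNReal.ofReal (payoff p W S I t (v ω) ω) ∂P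

/-- The value `H(S, t) = V₃(S, I, t) - I` of the stock loan excluding the accumulated dividends.
It does not depend on `I` (see `V3_eq_add`), so it is taken at `I = 0`. -/
noncomputable def H (p : Params) (ℱ : Filtration ℝ≥0 mΩ) (W : ℝ≥0 → Ω → ℝ) (P : Measure Ω)
    (T : ℝ≥0) (S : ℝ) (t : ℝ≥0) : ℝ :=
  (V3 p ℱ W P T S 0 t).toReal

/-- The domain `Q = (0, ∞) × [0, T)`. -/
def Q (T : ℝ≥0) : Set (ℝ × ℝ≥0) :=
  {q | 0 < q.1 ∧ q.2 < T}

/-- The redemption region `E₃ = {(S, t) ∈ Q : H(S, t) = S - K e^{γt}}`. -/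
def E3 (p : Params) (ℱ : Filtration ℝ≥0 mΩ) (W : ℝ≥0 → Ω → ℝ) (P : Measure Ω)
    (T : ℝ≥0) : Set (ℝ × ℝ≥0) :=
  {q ∈ Q T | H p ℱ W P T q.1 q.2 = q.1 - p.K * Real.exp (p.γ * q.2)}

/-- The redeeming boundary `S₃*(t)`: the least stock price at which the loan is redeemed at
time `t`. -/
noncomputable def S3star (p : Params) (ℱ : Filtration ℝ≥0 mΩ) (W : ℝ≥0 → Ω → ℝ)
    (P : Measure Ω) (T t : ℝ≥0) : ℝ :=
  sInf {S : ℝ | (S, t) ∈ E3 p ℱ W P T}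

/-- `V₃(S, I, t) - I` does not depend on `I`. -/
theorem V3_eq_add (p : Params) (ℱ : Filtration ℝ≥0 mΩ) (W : ℝ≥0 → Ω → ℝ) (P : Measure Ω)
    [IsProbabilityMeasure P] (T t : ℝ≥0) (htT : t ≤ T) (S I : ℝ) (hS : 0 ≤ S) (hI : 0 ≤ I)
    (hδ : 0 ≤ p.δ) :
    V3 p ℱ W P T S I t = ENNReal.ofReal I + V3 p ℱ W P T S 0 t := by
  have key : ∀ v ∈ stoppingTimes ℱ t T,
      ∫⁻ ω, ENNReal.ofReal (payoff p W S I t (v ω) ω) ∂P =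
        ENNReal.ofReal I + ∫⁻ ω, ENNReal.ofReal (payoff p W S 0 t (v ω) ω) ∂P := by
    intro v hv
    have h : ∀ ω, ENNReal.ofReal (payoff p W S I t (v ω) ω) =
        ENNReal.ofReal I + ENNReal.ofReal (payoff p W S 0 t (v ω) ω) := by
      intro ω
      have hJ : 0 ≤ ∫ u in (t : ℝ)..(v ω : ℝ),
          p.δ * Real.exp (p.r * ((v ω : ℝ) - u)) * stock p W S t u.toNNReal ω := by
        refine intervalIntegral.integral_nonneg (by exact_mod_cast (hv.2 ω).1) fun u _ => ?_
        unfold stock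
        positivity
      rw [← ENNReal.ofReal_add hI]
      · congr 1
        unfold payoff accDiv
        have he : Real.exp (-p.r * ((v ω : ℝ) - t)) * Real.exp (p.r * ((v ω : ℝ) - t)) = 1 := by
          rw [← Real.exp_add]; simp
        linear_combination I * he
      · unfold payoff accDiv
        positivity
    simp_rw [h]
    rw [lintegral_add_left measurable_const]
    simp
  have hne : (stoppingTimes ℱ t T).Nonempty :=
    ⟨fun _ => t, isStoppingTime_const ℱ t, fun _ => ⟨le_rfl, htT⟩⟩
  unfold V3
  rw [ENNReal.add_biSup hne]
  exact iSup_congr fun v => iSup_congr fun hv => key v hv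

end

end StockLoan

open StockLoan

/-! Discounted to time `t`, the stock is `S e^{-δ(v-t)} M_v` with `M` the exponential martingale of
parameter `σ`, and the dividends paid up to `v` are `S ∫ δ e^{-δ(u-t)} M_u du`. Optional sampling
bounds the mean of the first by that of `S e^{-δ(v-t)} M_T`; since `{u ≤ v}` lies in `ℱ u`, Tonelli
gives the second the mean of `S (1 - e^{-δ(v-t)}) M_T`. Together they cost at most `S`
(`lintegral_unitStock_add_unitDiv_le`). As the call payoff is 1-Lipschitz in the stock, `H` is
nondecreasing and 1-Lipschitz in `S`, vanishes at `0`, and so is at most `S`. Waiting until `T`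
collects dividends worth `S (1 - e^{-δ(T-t)})`, which tends to `S`: this is the first claim.

For the boundary, the Lipschitz bound makes each time section of `E3` upward closed, and
monotonicity of `H` puts its infimum in it. That the section is nonempty when `r < γ` is the
delicate point: `max_sub_add_le` dominates the payoff pathwise at one explicit price, using
`e^{-x/2} cosh b`, the mean of the exponential martingales with parameters `1` and `-1`. Finally, `H
→ S` expels every fixed price from the section as `T` grows. -/

namespace StockLoan

/-! ### Exponential martingales of Brownian motion -/

variable {Ω : Type*} {mΩ : MeasurableSpace Ω}

/-- The exponential martingale `exp(l (W_u - W_t) - l² (u - t) / 2)` started at time `t`. -/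
noncomputable def expMart (W : ℝ≥0 → Ω → ℝ) (l : ℝ) (t u : ℝ≥0) (ω : Ω) : ℝ :=
  Real.exp (l * (W u ω - W t ω) - l ^ 2 / 2 * ((u : ℝ) - t))

lemma expMart_pos (W : ℝ≥0 → Ω → ℝ) (l : ℝ) (t u : ℝ≥0) (ω : Ω) : 0 < expMart W l t u ω :=
  Real.exp_pos _

@[simp] lemma expMart_self (W : ℝ≥0 → Ω → ℝ) (l : ℝ) (t : ℝ≥0) (ω : Ω) :
    expMart W l t t ω = 1 := by
  simp [expMart]

lemma expMart_mul (W : ℝ≥0 → Ω → ℝ) (l : ℝ) (t s u : ℝ≥0) (ω : Ω) :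
    expMart W l s u ω * expMart W l t s ω = expMart W l t u ω := by
  unfold expMart
  rw [← Real.exp_add]
  ring_nf

section Brownian

variable {W : ℝ≥0 → Ω → ℝ} {ℱ : Filtration ℝ≥0 mΩ} {P : Measure Ω}

lemma lintegral_expMart (hW : IsPreBrownianReal W P) (l : ℝ) {t u : ℝ≥0} (htu : t ≤ u) :
    ∫⁻ ω, ENNReal.ofReal (expMart W l t u ω) ∂P = 1 := by
  have hlaw := hW.hasLaw_sub u t
  have hc : ((nndist (u : ℝ) t : ℝ≥0) : ℝ) = u - t := by
    rw [coe_nndist, Real.dist_eq, abs_of_nonneg (sub_nonneg.2 (by exact_mod_cast htu))]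
  have h1 : ∫⁻ ω, ENNReal.ofReal (expMart W l t u ω) ∂P
      = ∫⁻ x, ENNReal.ofReal (Real.exp (l * x - l ^ 2 / 2 * ((u : ℝ) - t)))
        ∂(gaussianReal 0 (nndist (u : ℝ) t)) := by
    exact hlaw.lintegral_comp
      (f := fun x => ENNReal.ofReal (Real.exp (l * x - l ^ 2 / 2 * ((u : ℝ) - t)))) (by fun_prop)
  rw [h1]
  simp_rw [sub_eq_add_neg (l * _), Real.exp_add, ENNReal.ofReal_mul (Real.exp_pos _).le]
  rw [lintegral_mul_const _ (by fun_prop), ← ofReal_integral_eq_lintegral_ofReal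
    (integrable_exp_mul_gaussianReal l) (ae_of_all _ fun _ => (Real.exp_pos _).le)]
  have := congrFun (mgf_id_gaussianReal (μ := 0) (v := nndist (u : ℝ) t)) l
  simp only [mgf, id] at this
  rw [this, hc, ← ENNReal.ofReal_mul (Real.exp_pos _).le, ← Real.exp_add]
  ring_nf
  simp

/-- The martingale property of the exponential martingale. -/
lemma setLIntegral_expMart (hW : IsFilteredBrownian W ℱ P) (l : ℝ) {t s u : ℝ≥0} (hts : t ≤ s)
    (hsu : s ≤ u) {A : Set Ω} (hA : MeasurableSet[ℱ s] A) :
    ∫⁻ ω in A, ENNReal.ofReal (expMart W l t u ω) ∂P =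
      ∫⁻ ω in A, ENNReal.ofReal (expMart W l t s ω) ∂P := by
  have hX : Measurable[MeasurableSpace.comap (fun ω => W u ω - W s ω) inferInstance]
      (fun ω => ENNReal.ofReal (expMart W l s u ω)) :=
    (show Measurable fun x : ℝ => ENNReal.ofReal
      (Real.exp (l * x - l ^ 2 / 2 * ((u : ℝ) - s))) by fun_prop).comp (comap_measurable _)
  have hY : Measurable[ℱ s] (A.indicator fun ω => ENNReal.ofReal (expMart W l t s ω)) := by
    have h1 : Measurable[ℱ s] (W s) := hW.adapted s
    have h2 : Measurable[ℱ s] (W t) := (hW.adapted t).mono (ℱ.mono hts) le_rfl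
    refine Measurable.indicator ?_ hA
    unfold expMart
    fun_prop
  have hm : ∀ v, Measurable (W v) := fun v => (hW.adapted v).mono (ℱ.le v) le_rfl
  -- The factor over `[s, u]` depends only on an increment independent of `ℱ s`, and has mean one.
  have key := lintegral_mul_eq_lintegral_mul_lintegral_of_independent_measurableSpace
    (((hm u).sub (hm s)).comap_le) (ℱ.le s) (hW.indep s u hsu) hX hY
  rw [lintegral_expMart hW.isBrownian.toIsPreBrownianReal l hsu, one_mul,
    lintegral_indicator (ℱ.le s _ hA)] at key
  rw [← key, ← lintegral_indicator (ℱ.le s _ hA)]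
  refine lintegral_congr fun ω => ?_
  by_cases hω : ω ∈ A
  · simp only [Set.indicator_of_mem hω]
    rw [← ENNReal.ofReal_mul (expMart_pos ..).le, expMart_mul]
  · simp [Set.indicator_of_notMem hω]

end Brownian

/-- The process `W` has continuous paths, and its exponentials are martingales for `ℱ`
(up to modification). -/
structure HasExpMart (W : ℝ≥0 → Ω → ℝ) (ℱ : Filtration ℝ≥0 mΩ) (P : Measure Ω) : Prop where
  continuous : ∀ ω, Continuous fun t => W t ω
  measurable : ∀ t, Measurable (W t)
  lintegral_eq_one : ∀ (l : ℝ) (t u : ℝ≥0), t ≤ u →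
    ∫⁻ ω, ENNReal.ofReal (expMart W l t u ω) ∂P = 1
  setLIntegral_eq : ∀ (l : ℝ) (t s u : ℝ≥0), t ≤ s → s ≤ u → ∀ A, MeasurableSet[ℱ s] A →
    ∫⁻ ω in A, ENNReal.ofReal (expMart W l t u ω) ∂P =
      ∫⁻ ω in A, ENNReal.ofReal (expMart W l t s ω) ∂P

/-- Paths are continuous only almost surely, so `W` is set to zero on a null set `N`. As `ℱ` is not
assumed complete, the result may fail to be adapted; `HasExpMart` therefore records only integral
identities, which ignore `N`. -/
lemma IsFilteredBrownian.exists_hasExpMart {W : ℝ≥0 → Ω → ℝ} {ℱ : Filtration ℝ≥0 mΩ}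
    {P : Measure Ω} (hW : IsFilteredBrownian W ℱ P) :
    ∃ W', HasExpMart W' ℱ P ∧ ∀ᵐ ω ∂P, ∀ t, W' t ω = W t ω := by
  obtain ⟨N, hN, hNm, hN0⟩ := exists_measurable_superset_of_null
    (ae_iff.1 hW.isBrownian.cont)
  have hae : ∀ᵐ ω ∂P, ∀ t, Nᶜ.indicator (W t) ω = W t ω := by
    filter_upwards [measure_eq_zero_iff_ae_notMem.1 hN0] with ω hω t
    simp [hω]
  have hexp : ∀ l t u, (fun ω => ENNReal.ofReal (expMart (fun t => Nᶜ.indicator (W t)) l t u ω))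
      =ᵐ[P] fun ω => ENNReal.ofReal (expMart W l t u ω) := by
    intro l t u
    filter_upwards [hae] with ω hω
    simp [expMart, hω]
  refine ⟨fun t => Nᶜ.indicator (W t), ⟨fun ω => ?_, fun t => ?_, fun l t u htu => ?_,
    fun l t s u hts hsu A hA => ?_⟩, hae⟩
  · by_cases hω : ω ∈ N
    · simpa [hω] using continuous_const
    · have : Continuous (W · ω) := by
        by_contra h
        exact hω (hN h)
      simpa [hω] using this
  · exact ((hW.adapted t).mono (ℱ.le t) le_rfl).indicator hNm.compl
  · rw [lintegral_congr_ae (hexp l t u),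
      lintegral_expMart hW.isBrownian.toIsPreBrownianReal l htu]
  · rw [lintegral_congr_ae (ae_restrict_of_ae (hexp l t u)),
      lintegral_congr_ae (ae_restrict_of_ae (hexp l t s)), setLIntegral_expMart hW l hts hsu hA]

/-- The exceptional null set must serve all times at once, because the payoff evaluates `W` at a
random time and along a path integral. -/
lemma H_congr (p : Params) (ℱ : Filtration ℝ≥0 mΩ) {W W' : ℝ≥0 → Ω → ℝ} {P : Measure Ω}
    (h : ∀ᵐ ω ∂P, ∀ t, W' t ω = W t ω) : H p ℱ W P = H p ℱ W' P := by
  ext T S t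
  unfold H V3
  congr 1
  refine iSup_congr fun v => iSup_congr fun _ => lintegral_congr_ae ?_
  filter_upwards [h] with ω hω
  simp only [payoff, accDiv, stock, hω]

/-! ### Optional sampling by discretisation -/

section Sampling

variable {ℱ : Filtration ℝ≥0 mΩ} {P : Measure Ω} {t T : ℝ≥0} {v : Ω → ℝ≥0}

lemma measurableSet_le_min (hv : v ∈ stoppingTimes ℱ t T) (c : ℝ≥0) :
    MeasurableSet[ℱ (min T c)] {ω | v ω ≤ c} := by
  have h := hv.1 (min T c)
  simpa only [WithTop.coe_le_coe, le_min_iff, (hv.2 _).2, true_and] using h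

lemma measurable_of_mem_stoppingTimes (hv : v ∈ stoppingTimes ℱ t T) : Measurable v :=
  measurable_of_Iic fun c => (ℱ.le _ _ (measurableSet_le_min hv c))

/-- The first multiple of `1 / (n + 1)` from `s` on, cut off at `T`. -/
noncomputable def roundUp (T : ℝ≥0) (n : ℕ) (s : ℝ≥0) : ℝ≥0 :=
  min T ((⌈s * (n + 1)⌉₊ : ℝ≥0) / (n + 1))

lemma le_roundUp {s : ℝ≥0} (hs : s ≤ T) (n : ℕ) : s ≤ roundUp T n s :=
  le_min hs ((le_div_iff₀ (by positivity)).2 (Nat.le_ceil _))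

lemma tendsto_roundUp {s : ℝ≥0} (hs : s ≤ T) :
    Tendsto (fun n => roundUp T n s) atTop (𝓝 s) := by
  have h : Tendsto (fun n : ℕ => (⌈s * ((n : ℝ≥0) + 1)⌉₊ : ℝ≥0) / ((n : ℝ≥0) + 1)) atTop (𝓝 s) := by
    refine tendsto_of_tendsto_of_tendsto_of_le_of_le (g := fun _ => s)
      (h := fun n : ℕ => s + 1 / ((n : ℝ≥0) + 1)) tendsto_const_nhds ?_ (fun n => ?_) fun n => ?_
    · have : Tendsto (fun n : ℕ => 1 / ((n : ℝ≥0) + 1)) atTop (𝓝 0) :=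
        tendsto_one_div_add_atTop_nhds_zero_nat
      simpa using tendsto_const_nhds.add this
    · exact (le_div_iff₀ (by positivity)).2 (Nat.le_ceil _)
    · have := (Nat.ceil_lt_add_one (zero_le (a := s * ((n : ℝ≥0) + 1)))).le
      simp only
      rw [div_le_iff₀ (by positivity), add_mul, div_mul_cancel₀ _ (by positivity)]
      exact this
  simpa [roundUp, hs] using tendsto_const_nhds (x := T).min h

/-- Optional sampling along the discretised stopping time. -/
lemma lintegral_roundUp {N : ℝ≥0 → Ω → ℝ≥0∞} {g : ℝ≥0 → ℝ≥0∞}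
    (hN : ∀ s, t ≤ s → s ≤ T → ∀ A, MeasurableSet[ℱ s] A →
      ∫⁻ ω in A, N T ω ∂P = ∫⁻ ω in A, N s ω ∂P)
    (hNm : ∀ s, Measurable (N s)) (hv : v ∈ stoppingTimes ℱ t T) (n : ℕ) :
    ∫⁻ ω, g (roundUp T n (v ω)) * N (roundUp T n (v ω)) ω ∂P =
      ∫⁻ ω, g (roundUp T n (v ω)) * N T ω ∂P := by
  -- On each level set of `κ` the rounded time is constant, and the set is known by that time, so
  -- the martingale identity applies level by level.
  set κ : Ω → ℕ := fun ω => ⌈v ω * (n + 1)⌉₊ with hκ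
  set c : ℕ → ℝ≥0 := fun k => (k : ℝ≥0) / (n + 1) with hc
  have hle : ∀ k ω, κ ω ≤ k ↔ v ω ≤ c k := fun k ω => by
    rw [hκ, hc, le_div_iff₀ (by positivity)]
    exact Nat.ceil_le
  have hset : ∀ k, MeasurableSet[ℱ (min T (c k))] {ω | κ ω = k} := by
    intro k
    have h1 : ∀ j ≤ k, MeasurableSet[ℱ (min T (c k))] {ω | κ ω ≤ j} := by
      intro j hj
      simp_rw [hle]
      refine ℱ.mono (min_le_min le_rfl ?_) _ (measurableSet_le_min hv (c j))
      simp only [hc]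
      gcongr
    rcases k with _ | k
    · simpa using h1 0 le_rfl
    · convert (h1 (k + 1) le_rfl).diff (h1 k (Nat.le_succ k)) using 1
      ext ω
      simp only [Set.mem_ofPred_eq, Set.mem_sdiff]
      omega
  have hpart : ∀ F : Ω → ℝ≥0∞, ∫⁻ ω, F ω ∂P = ∑' k, ∫⁻ ω in {ω | κ ω = k}, F ω ∂P := by
    intro F
    rw [← lintegral_iUnion (fun k => ℱ.le _ _ (hset k)), ← setLIntegral_univ]
    · congr 2
      ext ω
      simp
    · intro i j hij
      refine Set.disjoint_left.2 fun ω hi hj => hij ?_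
      rw [← hi, ← hj]
  rw [hpart, hpart (fun ω => g (roundUp T n (v ω)) * N T ω)]
  refine tsum_congr fun k => ?_
  have hround : ∀ ω ∈ {ω | κ ω = k}, roundUp T n (v ω) = min T (c k) := by
    rintro ω rfl
    rfl
  have hmk := ℱ.le _ _ (hset k)
  have hL : ∫⁻ ω in {ω | κ ω = k}, g (roundUp T n (v ω)) * N (roundUp T n (v ω)) ω ∂P =
      ∫⁻ ω in {ω | κ ω = k}, g (min T (c k)) * N (min T (c k)) ω ∂P :=
    setLIntegral_congr_fun hmk fun ω hω => by simp only [hround ω hω]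
  have hR : ∫⁻ ω in {ω | κ ω = k}, g (roundUp T n (v ω)) * N T ω ∂P =
      ∫⁻ ω in {ω | κ ω = k}, g (min T (c k)) * N T ω ∂P :=
    setLIntegral_congr_fun hmk fun ω hω => by simp only [hround ω hω]
  rw [hL, hR, lintegral_const_mul _ (hNm _), lintegral_const_mul _ (hNm _)]
  -- An empty level may correspond to a time before `t`, where `hN` says nothing.
  rcases Set.eq_empty_or_nonempty {ω | κ ω = k} with he | ⟨ω, hω⟩
  · simp [he]
  · rw [hN _ ?_ (min_le_left _ _) _ (hset k)]
    rw [← hround ω hω]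
    exact (hv.2 ω).1.trans (le_roundUp (hv.2 ω).2 n)

/-- Optional sampling inequality for a nonnegative continuous martingale and a nonincreasing
continuous weight. -/
lemma lintegral_stopped_le {N : ℝ≥0 → Ω → ℝ≥0∞} {g : ℝ≥0 → ℝ≥0∞}
    (hN : ∀ s, t ≤ s → s ≤ T → ∀ A, MeasurableSet[ℱ s] A →
      ∫⁻ ω in A, N T ω ∂P = ∫⁻ ω in A, N s ω ∂P)
    (hNm : Measurable (Function.uncurry N)) (hc : ∀ ω, Continuous fun s => g s * N s ω)
    (hg : Antitone g) (hv : v ∈ stoppingTimes ℱ t T) :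
    ∫⁻ ω, g (v ω) * N (v ω) ω ∂P ≤ ∫⁻ ω, g (v ω) * N T ω ∂P := by
  have hvm := measurable_of_mem_stoppingTimes hv
  have hround : ∀ n, Measurable fun ω => roundUp T n (v ω) := by
    intro n
    unfold roundUp
    exact measurable_const.min (((measurable_from_top (f := fun k : ℕ => (k : ℝ≥0))).comp
      (Nat.measurable_ceil.comp (hvm.mul_const _))).div_const _)
  have hNs : ∀ s, Measurable (N s) := fun s => hNm.comp measurable_prodMk_left
  calc ∫⁻ ω, g (v ω) * N (v ω) ω ∂P
      = ∫⁻ ω, liminf (fun n => g (roundUp T n (v ω)) * N (roundUp T n (v ω)) ω) atTop ∂P := by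
        refine lintegral_congr fun ω => (Tendsto.liminf_eq ?_).symm
        exact ((hc ω).tendsto (v ω)).comp (tendsto_roundUp (hv.2 ω).2)
    -- Fatou's lemma avoids any uniform integrability, and is why only an inequality results.
    _ ≤ liminf (fun n => ∫⁻ ω, g (roundUp T n (v ω)) * N (roundUp T n (v ω)) ω ∂P) atTop :=
        lintegral_liminf_le fun n => (hg.measurable.comp (hround n)).mul
          (hNm.comp ((hround n).prodMk measurable_id))
    _ = liminf (fun n => ∫⁻ ω, g (roundUp T n (v ω)) * N T ω ∂P) atTop := by
        simp_rw [lintegral_roundUp hN hNs hv]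
    _ ≤ ∫⁻ ω, g (v ω) * N T ω ∂P := by
        refine liminf_le_of_le (by isBoundedDefault) fun b hb => ?_
        obtain ⟨n, hn⟩ := hb.exists
        refine hn.trans (lintegral_mono fun ω => ?_)
        gcongr
        exact hg (le_roundUp (hv.2 ω).2 n)

end Sampling

end StockLoan

/-! ### Expected discounted stock and dividends -/

namespace StockLoan

variable {Ω : Type*} {mΩ : MeasurableSpace Ω}

/-- The discounted stock price per unit of initial price. -/
noncomputable def unitStock (p : Params) (W : ℝ≥0 → Ω → ℝ) (t v : ℝ≥0) (ω : Ω) : ℝ :=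
  Real.exp (-p.δ * ((v : ℝ) - t)) * expMart W p.σ t v ω

/-- The discounted accumulated dividends per unit of initial price. -/
noncomputable def unitDiv (p : Params) (W : ℝ≥0 → Ω → ℝ) (t v : ℝ≥0) (ω : Ω) : ℝ :=
  ∫ u in (t : ℝ)..(v : ℝ),
    p.δ * Real.exp (-p.δ * (u - t)) * expMart W p.σ t u.toNNReal ω

lemma payoff_eq (p : Params) (W : ℝ≥0 → Ω → ℝ) (S : ℝ) {t v : ℝ≥0} (htv : t ≤ v) (ω : Ω) :
    payoff p W S 0 t v ω =
      max (S * unitStock p W t v ω - p.K * Real.exp (p.γ * v - p.r * ((v : ℝ) - t))) 0 +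
        S * unitDiv p W t v ω := by
  have htv' : (t : ℝ) ≤ v := by exact_mod_cast htv
  unfold payoff accDiv unitDiv
  rw [mul_add, mul_max_of_nonneg _ _ (Real.exp_pos _).le, mul_zero, mul_sub, mul_zero, zero_add,
    ← intervalIntegral.integral_const_mul, ← intervalIntegral.integral_const_mul]
  congr 1
  · congr 2
    · unfold stock unitStock expMart
      rw [mul_left_comm, ← Real.exp_add, ← Real.exp_add]
      ring_nf
    · rw [mul_left_comm, ← Real.exp_add]
      ring_nf
  · refine intervalIntegral.integral_congr fun u hu => ?_
    rw [Set.uIcc_of_le htv'] at hu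
    have hu0 : (u.toNNReal : ℝ) = u := Real.coe_toNNReal _ (t.2.trans hu.1)
    have : Real.exp (-p.r * ((v : ℝ) - t)) * Real.exp (p.r * ((v : ℝ) - u)) *
        Real.exp ((p.r - p.δ - p.σ ^ 2 / 2) * (u - t) + p.σ * (W u.toNNReal ω - W t ω)) =
        Real.exp (-p.δ * (u - t)) *
          Real.exp (p.σ * (W u.toNNReal ω - W t ω) - p.σ ^ 2 / 2 * (u - t)) := by
      simp_rw [← Real.exp_add]
      ring_nf
    simp only [stock, expMart, hu0]
    linear_combination p.δ * S * this

lemma unitStock_pos (p : Params) (W : ℝ≥0 → Ω → ℝ) (t v : ℝ≥0) (ω : Ω) :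
    0 < unitStock p W t v ω :=
  mul_pos (Real.exp_pos _) (expMart_pos ..)

lemma unitDiv_nonneg (p : Params) (hδ : 0 ≤ p.δ) (W : ℝ≥0 → Ω → ℝ) {t v : ℝ≥0} (htv : t ≤ v)
    (ω : Ω) : 0 ≤ unitDiv p W t v ω :=
  intervalIntegral.integral_nonneg (by exact_mod_cast htv) fun u _ =>
    mul_nonneg (by positivity) (expMart_pos ..).le

section Expectations

variable {W : ℝ≥0 → Ω → ℝ} {ℱ : Filtration ℝ≥0 mΩ} {P : Measure Ω} {t T : ℝ≥0} {v : Ω → ℝ≥0}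

lemma HasExpMart.continuous_expMart (hW : HasExpMart W ℱ P) (l : ℝ) (t : ℝ≥0) (ω : Ω) :
    Continuous fun u => expMart W l t u ω := by
  have := hW.continuous ω
  unfold expMart
  fun_prop

lemma HasExpMart.measurable_expMart (hW : HasExpMart W ℱ P) (l : ℝ) (t : ℝ≥0) :
    Measurable (Function.uncurry fun u => expMart W l t u) := by
  refine measurable_uncurry_of_continuous_of_measurable (hW.continuous_expMart l t) fun u => ?_
  have h1 := hW.measurable u
  have h2 := hW.measurable t
  unfold expMart
  fun_prop

/-- Keeping the weight at the stopping time while moving the martingale to `T` is what lets this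
bound add up with `lintegral_unitDiv`. -/
lemma HasExpMart.lintegral_mul_expMart_le (hW : HasExpMart W ℱ P) (l : ℝ) {a : ℝ} (ha : 0 ≤ a)
    (hv : v ∈ stoppingTimes ℱ t T) :
    ∫⁻ ω, ENNReal.ofReal (Real.exp (-a * ((v ω : ℝ) - t)) * expMart W l t (v ω) ω) ∂P ≤
      ∫⁻ ω, ENNReal.ofReal (Real.exp (-a * ((v ω : ℝ) - t)) * expMart W l t T ω) ∂P := by
  have key := lintegral_stopped_le (P := P) (ℱ := ℱ) (t := t) (T := T) (v := v)
    (N := fun u ω => ENNReal.ofReal (expMart W l t u ω))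
    (g := fun s => ENNReal.ofReal (Real.exp (-a * ((s : ℝ) - t))))
    (fun s hts hsT A hA => hW.setLIntegral_eq l t s T hts hsT A hA)
    (ENNReal.measurable_ofReal.comp (hW.measurable_expMart l t)) (fun ω => ?_)
    (fun x y hxy => ?_) hv
  · simp_rw [ENNReal.ofReal_mul (Real.exp_pos _).le]
    exact key
  · simp_rw [← ENNReal.ofReal_mul (Real.exp_pos _).le]
    have := hW.continuous_expMart l t ω
    exact ENNReal.continuous_ofReal.comp (by fun_prop)
  · have : (x : ℝ) ≤ y := by exact_mod_cast hxy
    refine ENNReal.ofReal_le_ofReal (Real.exp_le_exp.2 ?_)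
    nlinarith

lemma measurableSet_ge_of_mem_stoppingTimes (hv : v ∈ stoppingTimes ℱ t T) (u : ℝ≥0) :
    MeasurableSet[ℱ u] {ω | u ≤ v ω} := by
  simpa only [Set.compl_ofPred, WithTop.coe_lt_coe, not_lt] using (hv.1.measurableSet_lt u).compl

lemma integral_exp_decay (a s x : ℝ) :
    ∫ u in s..x, a * Real.exp (-a * (u - s)) = 1 - Real.exp (-a * (x - s)) := by
  have h : ∀ u ∈ Set.uIcc s x, HasDerivAt (fun u => -Real.exp (-a * (u - s)))
      (a * Real.exp (-a * (u - s))) u := by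
    intro u _
    have := ((((hasDerivAt_id' u).sub_const s).const_mul (-a)).exp).neg
    rwa [show -(Real.exp (-a * (u - s)) * (-a * 1)) = a * Real.exp (-a * (u - s)) by ring] at this
  rw [intervalIntegral.integral_eq_sub_of_hasDerivAt h
    (Continuous.intervalIntegrable (by fun_prop) _ _)]
  simp
  ring

lemma HasExpMart.measurable_unitDiv_integrand (hW : HasExpMart W ℱ P) (p : Params) (t : ℝ≥0) :
    Measurable fun q : Ω × ℝ => ENNReal.ofReal (p.δ * Real.exp (-p.δ * (q.2 - t)) *
      expMart W p.σ t q.2.toNNReal q.1) := by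
  have h := (hW.measurable_expMart p.σ t).comp
    ((measurable_real_toNNReal.comp measurable_snd).prodMk measurable_fst :
      Measurable fun q : Ω × ℝ => (q.2.toNNReal, q.1))
  refine ENNReal.measurable_ofReal.comp (Measurable.mul (by fun_prop) h)

/-- Moves a variable upper limit into an indicator over a fixed interval, the form in which Tonelli
applies when the limit is random. -/
lemma ofReal_intervalIntegral_eq {f : ℝ → ℝ} (hf : Continuous f) {a b c : ℝ} (hab : a ≤ b)
    (hbc : b ≤ c) (h0 : ∀ x, 0 ≤ f x) :
    ENNReal.ofReal (∫ u in a..b, f u) =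
      ∫⁻ u in Set.Ioc a c, (Set.Iic b).indicator (fun u => ENNReal.ofReal (f u)) u := by
  rw [intervalIntegral.integral_of_le hab, ofReal_integral_eq_lintegral_ofReal
    (hf.integrableOn_Ioc) (ae_of_all _ h0), lintegral_indicator measurableSet_Iic,
    Measure.restrict_restrict measurableSet_Iic]
  congr 2
  ext u
  simp only [Set.mem_Ioc, Set.mem_inter_iff, Set.mem_Iic]
  constructor
  · rintro ⟨h1, h2⟩
    exact ⟨h2, h1, h2.trans hbc⟩
  · rintro ⟨h1, h2, _⟩
    exact ⟨h2, h1⟩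

lemma HasExpMart.ofReal_unitDiv (hW : HasExpMart W ℱ P) (p : Params) (hδ : 0 ≤ p.δ)
    {s : ℝ≥0} (hts : t ≤ s) (hsT : s ≤ T) (ω : Ω) :
    ENNReal.ofReal (unitDiv p W t s ω) =
      ∫⁻ u in Set.Ioc (t : ℝ) T, (Set.Iic (s : ℝ)).indicator
        (fun u => ENNReal.ofReal (p.δ * Real.exp (-p.δ * (u - t)) *
          expMart W p.σ t u.toNNReal ω)) u := by
  have := (hW.continuous_expMart p.σ t ω).comp continuous_real_toNNReal
  exact ofReal_intervalIntegral_eq (Continuous.mul (by fun_prop) this) (by exact_mod_cast hts)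
    (by exact_mod_cast hsT) fun u => mul_nonneg (by positivity) (expMart_pos ..).le

lemma indicator_Iic_apply (f : Ω × ℝ → ℝ≥0∞) (v : Ω → ℝ≥0) (ω : Ω) (u : ℝ) :
    (Set.Iic (v ω : ℝ)).indicator (fun u => f (ω, u)) u =
      {q : Ω × ℝ | q.2 ≤ v q.1}.indicator f (ω, u) := by
  simp only [Set.indicator, Set.mem_Iic, Set.mem_ofPred_eq]

lemma HasExpMart.measurable_ofReal_unitDiv (hW : HasExpMart W ℱ P) (p : Params) (hδ : 0 ≤ p.δ)
    (hv : v ∈ stoppingTimes ℱ t T) :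
    Measurable fun ω => ENNReal.ofReal (unitDiv p W t (v ω) ω) := by
  have hvm := measurable_of_mem_stoppingTimes hv
  have hset : MeasurableSet {q : Ω × ℝ | q.2 ≤ v q.1} :=
    measurableSet_le measurable_snd (by fun_prop)
  simp_rw [fun ω => hW.ofReal_unitDiv p hδ (hv.2 ω).1 (hv.2 ω).2 ω, fun ω u =>
    indicator_Iic_apply (fun q : Ω × ℝ => ENNReal.ofReal (p.δ * Real.exp (-p.δ * (q.2 - t)) *
      expMart W p.σ t q.2.toNNReal q.1)) v ω u]
  exact ((hW.measurable_unitDiv_integrand p t).indicator hset).lintegral_prod_right'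

/-- After Tonelli, for each `u` the event `{u ≤ v}` belongs to `ℱ u`, so `M_u` may be replaced by
`M_T` on it; undoing the swap leaves the deterministic integral of `δ e^{-δ(u-t)}` up to `v`. -/
lemma HasExpMart.lintegral_unitDiv [SFinite P] (hW : HasExpMart W ℱ P) (p : Params)
    (hδ : 0 ≤ p.δ) (hv : v ∈ stoppingTimes ℱ t T) :
    ∫⁻ ω, ENNReal.ofReal (unitDiv p W t (v ω) ω) ∂P =
      ∫⁻ ω, ENNReal.ofReal ((1 - Real.exp (-p.δ * ((v ω : ℝ) - t))) *
        expMart W p.σ t T ω) ∂P := by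
  have hvm := measurable_of_mem_stoppingTimes hv
  have htv : ∀ ω, (t : ℝ) ≤ v ω := fun ω => by exact_mod_cast (hv.2 ω).1
  have hvT : ∀ ω, (v ω : ℝ) ≤ T := fun ω => by exact_mod_cast (hv.2 ω).2
  have hset : MeasurableSet {q : Ω × ℝ | q.2 ≤ v q.1} :=
    measurableSet_le measurable_snd (by fun_prop)
  have hswap : ∀ f : Ω × ℝ → ℝ≥0∞, Measurable f →
      ∫⁻ ω, (∫⁻ u in Set.Ioc (t : ℝ) T,
          (Set.Iic (v ω : ℝ)).indicator (fun u => f (ω, u)) u) ∂P =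
        ∫⁻ u in Set.Ioc (t : ℝ) T, ∫⁻ ω in {ω | u ≤ v ω}, f (ω, u) ∂P := by
    intro f hf
    simp_rw [indicator_Iic_apply]
    rw [lintegral_lintegral_swap (f := fun ω u => {q : Ω × ℝ | q.2 ≤ v q.1}.indicator f (ω, u))
      (hf.indicator hset).aemeasurable]
    refine lintegral_congr fun u => ?_
    rw [← lintegral_indicator (measurableSet_le measurable_const (by fun_prop))]
    rfl
  have hA := fun ω => hW.ofReal_unitDiv p hδ (hv.2 ω).1 (hv.2 ω).2 ω
  have hB : ∀ ω, ENNReal.ofReal ((1 - Real.exp (-p.δ * ((v ω : ℝ) - t))) *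
        expMart W p.σ t T ω) =
      ∫⁻ u in Set.Ioc (t : ℝ) T, (Set.Iic (v ω : ℝ)).indicator
        (fun u => ENNReal.ofReal (p.δ * Real.exp (-p.δ * (u - t)) * expMart W p.σ t T ω)) u := by
    intro ω
    rw [← integral_exp_decay, ← intervalIntegral.integral_mul_const]
    exact ofReal_intervalIntegral_eq (by fun_prop) (htv ω) (hvT ω)
      fun u => mul_nonneg (by positivity) (expMart_pos ..).le
  have hTm : Measurable (expMart W p.σ t T) :=
    (hW.measurable_expMart p.σ t).comp measurable_prodMk_left
  simp_rw [hA, hB]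
  rw [hswap _ (hW.measurable_unitDiv_integrand p t),
    hswap (fun q => ENNReal.ofReal (p.δ * Real.exp (-p.δ * (q.2 - t)) * expMart W p.σ t T q.1))
      (by fun_prop)]
  refine setLIntegral_congr_fun measurableSet_Ioc fun u hu => ?_
  have hu0 : 0 ≤ u := t.2.trans hu.1.le
  have hut : t ≤ u.toNNReal := NNReal.le_toNNReal_of_coe_le hu.1.le
  have huT : u.toNNReal ≤ T := Real.toNNReal_le_iff_le_coe.2 hu.2
  have hAu := measurableSet_ge_of_mem_stoppingTimes hv u.toNNReal
  have hAeq : {ω | u ≤ v ω} = {ω | u.toNNReal ≤ v ω} := by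
    ext ω
    simp [Real.toNNReal_le_iff_le_coe]
  have hum : Measurable (expMart W p.σ t u.toNNReal) :=
    (hW.measurable_expMart p.σ t).comp measurable_prodMk_left
  have hw : 0 ≤ p.δ * Real.exp (-p.δ * (u - t)) := by positivity
  simp only [hAeq, ENNReal.ofReal_mul hw]
  rw [lintegral_const_mul _ hum.ennreal_ofReal, lintegral_const_mul _ hTm.ennreal_ofReal,
    hW.setLIntegral_eq _ _ _ _ hut huT _ hAu]

lemma HasExpMart.measurable_unitStock (hW : HasExpMart W ℱ P) (p : Params)
    (hv : v ∈ stoppingTimes ℱ t T) : Measurable fun ω => unitStock p W t (v ω) ω := by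
  have hvm := measurable_of_mem_stoppingTimes hv
  have h : Measurable fun ω => expMart W p.σ t (v ω) ω :=
    (hW.measurable_expMart p.σ t).comp (hvm.prodMk measurable_id)
  unfold unitStock
  fun_prop

/-- Holding one unit of stock with its dividends until a stopping time costs at most its price. -/
lemma HasExpMart.lintegral_unitStock_add_unitDiv_le [SFinite P] (hW : HasExpMart W ℱ P)
    (p : Params) (hδ : 0 ≤ p.δ) (htT : t ≤ T) (hv : v ∈ stoppingTimes ℱ t T) :
    ∫⁻ ω, ENNReal.ofReal (unitStock p W t (v ω) ω + unitDiv p W t (v ω) ω) ∂P ≤ 1 := by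
  have hTm : Measurable (expMart W p.σ t T) :=
    (hW.measurable_expMart p.σ t).comp measurable_prodMk_left
  have hvm := measurable_of_mem_stoppingTimes hv
  calc ∫⁻ ω, ENNReal.ofReal (unitStock p W t (v ω) ω + unitDiv p W t (v ω) ω) ∂P
      = ∫⁻ ω, ENNReal.ofReal (unitStock p W t (v ω) ω) ∂P +
          ∫⁻ ω, ENNReal.ofReal (unitDiv p W t (v ω) ω) ∂P := by
        rw [← lintegral_add_left (hW.measurable_unitStock p hv).ennreal_ofReal]
        exact lintegral_congr fun ω => ENNReal.ofReal_add (unitStock_pos ..).le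
          (unitDiv_nonneg p hδ W (hv.2 ω).1 ω)
    _ ≤ ∫⁻ ω, ENNReal.ofReal (Real.exp (-p.δ * ((v ω : ℝ) - t)) * expMart W p.σ t T ω) ∂P +
          ∫⁻ ω, ENNReal.ofReal ((1 - Real.exp (-p.δ * ((v ω : ℝ) - t))) *
            expMart W p.σ t T ω) ∂P :=
        add_le_add (hW.lintegral_mul_expMart_le p.σ hδ hv) (hW.lintegral_unitDiv p hδ hv).le
    -- The two weights on `M_T` add up to one.
    _ = ∫⁻ ω, ENNReal.ofReal (expMart W p.σ t T ω) ∂P := by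
        rw [← lintegral_add_left (by fun_prop)]
        refine lintegral_congr fun ω => ?_
        have h1 : (t : ℝ) ≤ v ω := by exact_mod_cast (hv.2 ω).1
        have h2 : Real.exp (-p.δ * ((v ω : ℝ) - t)) ≤ 1 :=
          Real.exp_le_one_iff.2 (by nlinarith)
        have h3 := (expMart_pos W p.σ t T ω).le
        rw [← ENNReal.ofReal_add (mul_nonneg (Real.exp_pos _).le h3)
          (mul_nonneg (sub_nonneg.2 h2) h3)]
        ring_nf
    _ = 1 := hW.lintegral_eq_one _ _ _ htT

lemma HasExpMart.lintegral_unitDiv_const [SFinite P] (hW : HasExpMart W ℱ P)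
    (p : Params) (hδ : 0 ≤ p.δ) (htT : t ≤ T) :
    ∫⁻ ω, ENNReal.ofReal (unitDiv p W t T ω) ∂P =
      ENNReal.ofReal (1 - Real.exp (-p.δ * ((T : ℝ) - t))) := by
  have hTm : Measurable (expMart W p.σ t T) :=
    (hW.measurable_expMart p.σ t).comp measurable_prodMk_left
  have htT' : (t : ℝ) ≤ T := by exact_mod_cast htT
  have hv : (fun _ => T) ∈ stoppingTimes ℱ t T :=
    ⟨isStoppingTime_const ℱ T, fun _ => ⟨htT, le_rfl⟩⟩
  rw [hW.lintegral_unitDiv p hδ hv]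
  simp_rw [ENNReal.ofReal_mul (sub_nonneg.2 (Real.exp_le_one_iff.2
    (by nlinarith : -p.δ * ((T : ℝ) - t) ≤ 0)))]
  rw [lintegral_const_mul _ hTm.ennreal_ofReal, hW.lintegral_eq_one _ _ _ htT, mul_one]

end Expectations

end StockLoan

/-! ### Bounds on the loan value and the perpetual limit -/

namespace StockLoan

variable {Ω : Type*} {mΩ : MeasurableSpace Ω} {W : ℝ≥0 → Ω → ℝ} {ℱ : Filtration ℝ≥0 mΩ}
  {P : Measure Ω} {p : Params} {t T : ℝ≥0}

lemma payoff_mono (hδ : 0 ≤ p.δ) {v : ℝ≥0} (htv : t ≤ v) {S S' : ℝ} (h : S ≤ S') (ω : Ω) :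
    payoff p W S 0 t v ω ≤ payoff p W S' 0 t v ω := by
  rw [payoff_eq p W S htv, payoff_eq p W S' htv]
  have := (unitStock_pos p W t v ω).le
  have := unitDiv_nonneg p hδ W htv ω
  gcongr

lemma payoff_nonneg (hδ : 0 ≤ p.δ) {v : ℝ≥0} (htv : t ≤ v) {S : ℝ} (hS : 0 ≤ S) (ω : Ω) :
    0 ≤ payoff p W S 0 t v ω := by
  rw [payoff_eq p W S htv]
  exact add_nonneg (le_max_right _ _) (mul_nonneg hS (unitDiv_nonneg p hδ W htv ω))

lemma payoff_le_add {v : ℝ≥0} (htv : t ≤ v) {S S' : ℝ} (h : S ≤ S') (ω : Ω) :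
    payoff p W S' 0 t v ω ≤
      payoff p W S 0 t v ω + (S' - S) * (unitStock p W t v ω + unitDiv p W t v ω) := by
  rw [payoff_eq p W S htv, payoff_eq p W S' htv]
  have h1 := mul_nonneg (sub_nonneg.2 h) (unitStock_pos p W t v ω).le
  set k := p.K * Real.exp (p.γ * v - p.r * ((v : ℝ) - t))
  have h2 : max (S' * unitStock p W t v ω - k) 0 ≤
      max (S * unitStock p W t v ω - k) 0 + (S' - S) * unitStock p W t v ω := by
    refine max_le ?_ (add_nonneg (le_max_right _ _) h1)
    linarith [le_max_left (S * unitStock p W t v ω - k) 0]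
  linarith

lemma HasExpMart.V3_le_add [SFinite P] (hW : HasExpMart W ℱ P) (hδ : 0 ≤ p.δ) (htT : t ≤ T)
    {S S' : ℝ} (hS : 0 ≤ S) (h : S ≤ S') :
    V3 p ℱ W P T S' 0 t ≤ V3 p ℱ W P T S 0 t + ENNReal.ofReal (S' - S) := by
  refine iSup₂_le fun v hv => ?_
  have hsum : ∀ ω, ENNReal.ofReal (unitStock p W t (v ω) ω + unitDiv p W t (v ω) ω) =
      ENNReal.ofReal (unitStock p W t (v ω) ω) + ENNReal.ofReal (unitDiv p W t (v ω) ω) :=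
    fun ω => ENNReal.ofReal_add (unitStock_pos ..).le (unitDiv_nonneg p hδ W (hv.2 ω).1 ω)
  have hm : Measurable fun ω =>
      ENNReal.ofReal (unitStock p W t (v ω) ω + unitDiv p W t (v ω) ω) := by
    simp_rw [hsum]
    exact (hW.measurable_unitStock p hv).ennreal_ofReal.add (hW.measurable_ofReal_unitDiv p hδ hv)
  calc ∫⁻ ω, ENNReal.ofReal (payoff p W S' 0 t (v ω) ω) ∂P
      ≤ ∫⁻ ω, (ENNReal.ofReal (payoff p W S 0 t (v ω) ω) + ENNReal.ofReal (S' - S) *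
          ENNReal.ofReal (unitStock p W t (v ω) ω + unitDiv p W t (v ω) ω)) ∂P := by
        refine lintegral_mono fun ω => ?_
        have h1 := sub_nonneg.2 h
        have h2 := add_nonneg (unitStock_pos p W t (v ω) ω).le
          (unitDiv_nonneg p hδ W (hv.2 ω).1 ω)
        rw [← ENNReal.ofReal_mul h1, ← ENNReal.ofReal_add
          (payoff_nonneg hδ (hv.2 ω).1 hS ω) (mul_nonneg h1 h2)]
        exact ENNReal.ofReal_le_ofReal (payoff_le_add (hv.2 ω).1 h ω)
    _ = ∫⁻ ω, ENNReal.ofReal (payoff p W S 0 t (v ω) ω) ∂P + ENNReal.ofReal (S' - S) *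
          ∫⁻ ω, ENNReal.ofReal (unitStock p W t (v ω) ω + unitDiv p W t (v ω) ω) ∂P := by
        rw [lintegral_add_right _ (hm.const_mul _), lintegral_const_mul _ hm]
    _ ≤ V3 p ℱ W P T S 0 t + ENNReal.ofReal (S' - S) * 1 := by
        gcongr
        · exact le_iSup₂ (f := fun v (_ : v ∈ stoppingTimes ℱ t T) =>
            ∫⁻ ω, ENNReal.ofReal (payoff p W S 0 t (v ω) ω) ∂P) v hv
        · exact hW.lintegral_unitStock_add_unitDiv_le p hδ htT hv
    _ = V3 p ℱ W P T S 0 t + ENNReal.ofReal (S' - S) := by rw [mul_one]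

lemma V3_mono (hδ : 0 ≤ p.δ) {S S' : ℝ} (h : S ≤ S') :
    V3 p ℱ W P T S 0 t ≤ V3 p ℱ W P T S' 0 t :=
  iSup₂_mono fun _ hv => lintegral_mono fun ω =>
    ENNReal.ofReal_le_ofReal (payoff_mono hδ (hv.2 ω).1 h ω)

lemma V3_zero (hK : 0 ≤ p.K) : V3 p ℱ W P T 0 0 t = 0 := by
  refine le_antisymm (iSup₂_le fun v hv => ?_) zero_le
  rw [lintegral_congr (g := fun _ => 0) fun ω => ?_, lintegral_zero]
  rw [payoff_eq p W 0 (hv.2 ω).1]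
  have : 0 ≤ p.K * Real.exp (p.γ * v ω - p.r * ((v ω : ℝ) - t)) := by positivity
  simpa using this

/-- This is the Lipschitz bound started from the price `0`, where the loan is worthless. -/
lemma HasExpMart.V3_le [SFinite P] (hW : HasExpMart W ℱ P) (hδ : 0 ≤ p.δ) (hK : 0 ≤ p.K)
    (htT : t ≤ T) {S : ℝ} (hS : 0 ≤ S) : V3 p ℱ W P T S 0 t ≤ ENNReal.ofReal S := by
  simpa [V3_zero hK] using hW.V3_le_add hδ htT le_rfl hS

lemma HasExpMart.ofReal_H [SFinite P] (hW : HasExpMart W ℱ P) (hδ : 0 ≤ p.δ) (hK : 0 ≤ p.K)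
    (htT : t ≤ T) {S : ℝ} (hS : 0 ≤ S) :
    ENNReal.ofReal (H p ℱ W P T S t) = V3 p ℱ W P T S 0 t :=
  ENNReal.ofReal_toReal (ne_top_of_le_ne_top ENNReal.ofReal_ne_top (hW.V3_le hδ hK htT hS))

lemma H_nonneg (S : ℝ) : 0 ≤ H p ℱ W P T S t := ENNReal.toReal_nonneg

lemma HasExpMart.H_le [SFinite P] (hW : HasExpMart W ℱ P) (hδ : 0 ≤ p.δ) (hK : 0 ≤ p.K)
    (htT : t ≤ T) {S : ℝ} (hS : 0 ≤ S) : H p ℱ W P T S t ≤ S :=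
  ENNReal.toReal_le_of_le_ofReal hS (hW.V3_le hδ hK htT hS)

lemma HasExpMart.H_le_add [SFinite P] (hW : HasExpMart W ℱ P) (hδ : 0 ≤ p.δ) (hK : 0 ≤ p.K)
    (htT : t ≤ T) {S S' : ℝ} (hS : 0 ≤ S) (h : S ≤ S') :
    H p ℱ W P T S' t ≤ H p ℱ W P T S t + (S' - S) := by
  refine ENNReal.toReal_le_of_le_ofReal (add_nonneg (H_nonneg S) (sub_nonneg.2 h)) ?_
  rw [ENNReal.ofReal_add (H_nonneg S) (sub_nonneg.2 h), hW.ofReal_H hδ hK htT hS]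
  exact hW.V3_le_add hδ htT hS h

lemma HasExpMart.H_mono [SFinite P] (hW : HasExpMart W ℱ P) (hδ : 0 ≤ p.δ) (hK : 0 ≤ p.K)
    (htT : t ≤ T) {S S' : ℝ} (hS : 0 ≤ S) (h : S ≤ S') :
    H p ℱ W P T S t ≤ H p ℱ W P T S' t :=
  ENNReal.toReal_mono (ne_top_of_le_ne_top ENNReal.ofReal_ne_top
    (hW.V3_le hδ hK htT (hS.trans h))) (V3_mono hδ h)

/-- Redeeming immediately bounds the value of the loan from below. -/
lemma HasExpMart.sub_le_H [IsProbabilityMeasure P] (hW : HasExpMart W ℱ P) (hδ : 0 ≤ p.δ)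
    (hK : 0 ≤ p.K) (htT : t ≤ T) {S : ℝ} (hS : 0 ≤ S) :
    S - p.K * Real.exp (p.γ * t) ≤ H p ℱ W P T S t := by
  rw [← ENNReal.ofReal_le_ofReal_iff (H_nonneg S), hW.ofReal_H hδ hK htT hS]
  refine le_trans ?_ (le_iSup₂ (f := fun v (_ : v ∈ stoppingTimes ℱ t T) =>
    ∫⁻ ω, ENNReal.ofReal (payoff p W S 0 t (v ω) ω) ∂P) (fun _ => t)
    ⟨isStoppingTime_const ℱ t, fun _ => ⟨le_rfl, htT⟩⟩)
  simp [payoff_eq p W S le_rfl, unitStock, unitDiv]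

/-- Redeeming at maturity bounds the value of the loan from below. -/
lemma HasExpMart.mul_le_H [SFinite P] (hW : HasExpMart W ℱ P) (hδ : 0 ≤ p.δ) (hK : 0 ≤ p.K)
    (htT : t ≤ T) {S : ℝ} (hS : 0 ≤ S) :
    S * (1 - Real.exp (-p.δ * ((T : ℝ) - t))) ≤ H p ℱ W P T S t := by
  have hv : (fun _ => T) ∈ stoppingTimes ℱ t T :=
    ⟨isStoppingTime_const ℱ T, fun _ => ⟨htT, le_rfl⟩⟩
  rw [← ENNReal.ofReal_le_ofReal_iff (H_nonneg S), hW.ofReal_H hδ hK htT hS]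
  refine le_trans ?_ (le_iSup₂ (f := fun v (_ : v ∈ stoppingTimes ℱ t T) =>
    ∫⁻ ω, ENNReal.ofReal (payoff p W S 0 t (v ω) ω) ∂P) (fun _ => T) hv)
  rw [ENNReal.ofReal_mul hS, ← hW.lintegral_unitDiv_const p hδ htT,
    ← lintegral_const_mul _ (hW.measurable_ofReal_unitDiv p hδ hv)]
  refine lintegral_mono fun ω => ?_
  simp only
  rw [← ENNReal.ofReal_mul hS, payoff_eq p W S htT]
  exact ENNReal.ofReal_le_ofReal (le_add_of_nonneg_left (le_max_right _ _))

/-- The value of the perpetual loan is the stock price. -/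
lemma HasExpMart.tendsto_H [SFinite P] (hW : HasExpMart W ℱ P) (hδ : 0 < p.δ) (hK : 0 ≤ p.K)
    {S : ℝ} (hS : 0 ≤ S) (t : ℝ≥0) :
    Tendsto (fun T : ℝ≥0 => H p ℱ W P T S t) atTop (𝓝 S) := by
  refine tendsto_of_tendsto_of_tendsto_of_le_of_le' (h := fun _ => S)
    (g := fun T : ℝ≥0 => S * (1 - Real.exp (-p.δ * ((T : ℝ) - t)))) ?_ tendsto_const_nhds ?_ ?_
  · have h1 : Tendsto (fun T : ℝ≥0 => (T : ℝ) - t) atTop atTop :=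
      tendsto_atTop_add_const_right _ (-(t : ℝ)) (NNReal.tendsto_coe_atTop.2 tendsto_id)
    have h2 := Real.tendsto_exp_atBot.comp (h1.const_mul_atTop_of_neg (neg_lt_zero.2 hδ))
    simpa using (h2.const_sub 1).const_mul S
  · filter_upwards [eventually_ge_atTop t] with T hT using hW.mul_le_H hδ.le hK hT hS
  · filter_upwards [eventually_ge_atTop t] with T hT using hW.H_le hδ.le hK hT hS

end StockLoan

/-! ### Redemption at high stock prices -/

namespace StockLoan

/-- A stock price above which a loan with remaining time `θ` and balance `k` is redeemed
immediately, where `c` is the excess of the loan rate over the riskless rate. -/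
noncomputable def redemptionPrice (k c δ σ θ : ℝ) : ℝ :=
  k * Real.exp (c * θ + σ * (2 * (Real.exp (θ / 2) * (1 + 1 / (2 * c)))) +
    (σ ^ 2 / 2 + δ) * θ)

/-- Here `x` is the elapsed time and `b` the Brownian increment. In the money, interest growth
`e^{cx} ≥ 1 + cx` pays for the loss in `e^{-x/2} cosh b ≥ 1 - x/2`; the coefficient `2kc` makes the
linear terms cancel. Out of the money, the price is so high that `b` must be very negative, and the
`cosh` term alone suffices. -/
lemma max_sub_add_le {k c δ σ θ x b : ℝ} (hk : 0 < k) (hc : 0 < c) (hδ : 0 ≤ δ) (hσ : 0 < σ)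
    (hx : x ≤ θ) :
    max (redemptionPrice k c δ σ θ * (Real.exp (-δ * x) * Real.exp (σ * b - σ ^ 2 / 2 * x)) -
        k * Real.exp (c * x)) 0 + (k + 2 * k * c) ≤
      redemptionPrice k c δ σ θ * (Real.exp (-δ * x) * Real.exp (σ * b - σ ^ 2 / 2 * x)) +
        2 * k * c * (Real.exp (-x / 2) * Real.cosh b) := by
  set a := 2 * (Real.exp (θ / 2) * (1 + 1 / (2 * c))) with ha
  set Y := Real.exp (-δ * x) * Real.exp (σ * b - σ ^ 2 / 2 * x) with hY
  have hkc : 0 < k * c := mul_pos hk hc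
  have hS : 0 < redemptionPrice k c δ σ θ := mul_pos hk (Real.exp_pos _)
  have hYpos : 0 < Y := by positivity
  rw [max_add]
  refine max_le ?_ ?_
  · have h1 : 1 - x / 2 ≤ Real.exp (-x / 2) * Real.cosh b := by
      have := Real.add_one_le_exp (-x / 2)
      nlinarith [Real.one_le_cosh b, Real.exp_pos (-x / 2)]
    have h2 : k * (c * x + 1) ≤ k * Real.exp (c * x) := by
      gcongr
      exact Real.add_one_le_exp _
    nlinarith [mul_le_mul_of_nonneg_left h1 hkc.le]
  · rcases le_or_gt (k * Real.exp (c * x)) (redemptionPrice k c δ σ θ * Y) with h | h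
    · have h1 : 1 - x / 2 ≤ Real.exp (-x / 2) * Real.cosh b := by
        have := Real.add_one_le_exp (-x / 2)
        nlinarith [Real.one_le_cosh b, Real.exp_pos (-x / 2)]
      have h2 : k * (c * x + 1) ≤ k * Real.exp (c * x) := by
        gcongr
        exact Real.add_one_le_exp _
      nlinarith [mul_le_mul_of_nonneg_left h1 hkc.le]
    -- The exponent in `redemptionPrice` is `σ a` plus the largest drift possible by time `θ`; and
    -- `a` is chosen so that `e^{-θ/2} a/2 = 1 + 1/(2c)`, hence `2kc` times it is `2kc + k`.
    · have hb : b < -a := by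
        rw [redemptionPrice, ← ha, hY, mul_assoc, ← Real.exp_add, ← Real.exp_add,
          mul_lt_mul_iff_right₀ hk, Real.exp_lt_exp] at h
        have h3 : c * x ≤ c * θ := by gcongr
        have h4 : (σ ^ 2 / 2 + δ) * x ≤ (σ ^ 2 / 2 + δ) * θ := by gcongr
        by_contra! hcon
        nlinarith [mul_le_mul_of_nonneg_left hcon hσ.le]
      have hcosh : a / 2 ≤ Real.cosh b := by
        rw [Real.cosh_eq]
        have := Real.add_one_le_exp (-b)
        have := Real.exp_pos b
        linarith
      have h1 : 1 + 1 / (2 * c) ≤ Real.exp (-x / 2) * Real.cosh b := by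
        calc 1 + 1 / (2 * c) = Real.exp (-θ / 2) * (a / 2) := by
              rw [ha, mul_div_cancel_left₀ _ two_ne_zero, ← mul_assoc, ← Real.exp_add]
              simp [neg_div]
          _ ≤ Real.exp (-x / 2) * Real.cosh b := by
              gcongr
      have h2 : 2 * k * c * (1 + 1 / (2 * c)) = 2 * k * c + k := by
        field_simp
      have h3 := mul_le_mul_of_nonneg_left h1 (by positivity : 0 ≤ 2 * k * c)
      have := mul_pos hS hYpos
      linarith

variable {Ω : Type*} {mΩ : MeasurableSpace Ω} {W : ℝ≥0 → Ω → ℝ} {ℱ : Filtration ℝ≥0 mΩ}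
  {P : Measure Ω} {p : Params} {t T : ℝ≥0}

lemma expMart_add_expMart_neg (W : ℝ≥0 → Ω → ℝ) (t v : ℝ≥0) (ω : Ω) :
    (expMart W 1 t v ω + expMart W (-1) t v ω) / 2 =
      Real.exp (-((v : ℝ) - t) / 2) * Real.cosh (W v ω - W t ω) := by
  rw [Real.cosh_eq, mul_div_assoc', mul_add, ← Real.exp_add, ← Real.exp_add]
  unfold expMart
  ring_nf

lemma HasExpMart.lintegral_expMart_stopped_le (hW : HasExpMart W ℱ P) (l : ℝ) (htT : t ≤ T)
    {v : Ω → ℝ≥0} (hv : v ∈ stoppingTimes ℱ t T) :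
    ∫⁻ ω, ENNReal.ofReal (expMart W l t (v ω) ω) ∂P ≤ 1 := by
  simpa [hW.lintegral_eq_one l t T htT] using hW.lintegral_mul_expMart_le l le_rfl hv

lemma HasExpMart.lintegral_cosh_le (hW : HasExpMart W ℱ P) (htT : t ≤ T)
    {v : Ω → ℝ≥0} (hv : v ∈ stoppingTimes ℱ t T) :
    ∫⁻ ω, ENNReal.ofReal (Real.exp (-((v ω : ℝ) - t) / 2) *
      Real.cosh (W (v ω) ω - W t ω)) ∂P ≤ 1 := by
  have hvm := measurable_of_mem_stoppingTimes hv
  have hm : ∀ l, Measurable fun ω => ENNReal.ofReal (expMart W l t (v ω) ω) := fun l =>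
    ((hW.measurable_expMart l t).comp (hvm.prodMk measurable_id)).ennreal_ofReal
  have h : ∀ ω, ENNReal.ofReal (Real.exp (-((v ω : ℝ) - t) / 2) *
      Real.cosh (W (v ω) ω - W t ω)) = (ENNReal.ofReal (expMart W 1 t (v ω) ω) +
        ENNReal.ofReal (expMart W (-1) t (v ω) ω)) * 2⁻¹ := by
    intro ω
    rw [← expMart_add_expMart_neg, ENNReal.ofReal_div_of_pos two_pos,
      ENNReal.ofReal_add (expMart_pos ..).le (expMart_pos ..).le, ENNReal.ofReal_ofNat,
      div_eq_mul_inv]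
  simp_rw [h]
  rw [lintegral_mul_const' _ _ (by simp), lintegral_add_left (hm 1)]
  calc _ ≤ ((1 : ℝ≥0∞) + 1) * 2⁻¹ := by
        gcongr
        · exact hW.lintegral_expMart_stopped_le 1 htT hv
        · exact hW.lintegral_expMart_stopped_le (-1) htT hv
    _ = 1 := by
        rw [one_add_one_eq_two]
        exact ENNReal.mul_inv_cancel two_ne_zero ENNReal.ofNat_ne_top

/-- When the loan rate exceeds the riskless rate, redeeming is optimal at high stock prices. -/
lemma HasExpMart.exists_H_le_sub [IsProbabilityMeasure P] (hW : HasExpMart W ℱ P) (hδ : 0 ≤ p.δ)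
    (hσ : 0 < p.σ) (hK : 0 < p.K) (hγ : p.r < p.γ) (htT : t ≤ T) :
    ∃ S, 0 < S ∧ H p ℱ W P T S t ≤ S - p.K * Real.exp (p.γ * t) := by
  set k := p.K * Real.exp (p.γ * t) with hk
  have hkpos : 0 < k := by positivity
  have hc : 0 < p.γ - p.r := sub_pos.2 hγ
  set S := redemptionPrice k (p.γ - p.r) p.δ p.σ ((T : ℝ) - t) with hS
  set β := 2 * k * (p.γ - p.r) with hβ
  have hβpos : 0 < β := by positivity
  have hSpos : 0 < S := mul_pos hkpos (Real.exp_pos _)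
  refine ⟨S, hSpos, ?_⟩
  -- The constants stay on the left to avoid truncated subtraction; the extra `β` is the cost of the
  -- `cosh` term, whose mean is at most one.
  suffices h : V3 p ℱ W P T S 0 t + ENNReal.ofReal (k + β) ≤ ENNReal.ofReal (S + β) by
    rw [← hW.ofReal_H hδ hK.le htT hSpos.le, ← ENNReal.ofReal_add (H_nonneg S) (by positivity),
      ENNReal.ofReal_le_ofReal_iff (by positivity)] at h
    linarith
  have hne : (stoppingTimes ℱ t T).Nonempty :=
    ⟨fun _ => t, isStoppingTime_const ℱ t, fun _ => ⟨le_rfl, htT⟩⟩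
  rw [V3, ENNReal.biSup_add hne]
  refine iSup₂_le fun v hv => ?_
  have hvm := measurable_of_mem_stoppingTimes hv
  set Z : Ω → ℝ := fun ω => Real.exp (-((v ω : ℝ) - t) / 2) * Real.cosh (W (v ω) ω - W t ω) with hZ
  have hZ0 : ∀ ω, 0 ≤ Z ω := fun ω => by have := Real.cosh_pos (W (v ω) ω - W t ω); positivity
  have hA0 : ∀ ω, 0 ≤ unitStock p W t (v ω) ω + unitDiv p W t (v ω) ω := fun ω =>
    add_nonneg (unitStock_pos ..).le (unitDiv_nonneg p hδ W (hv.2 ω).1 ω)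
  have hZm : Measurable fun ω => ENNReal.ofReal (Z ω) := by
    have h1 : Measurable fun ω => W (v ω) ω := (measurable_uncurry_of_continuous_of_measurable
      hW.continuous hW.measurable).comp (hvm.prodMk measurable_id)
    have h2 := hW.measurable t
    have h3 : Measurable fun ω => Real.cosh (W (v ω) ω - W t ω) :=
      Real.measurable_cosh.comp (h1.sub h2)
    exact (Measurable.mul (by fun_prop) h3).ennreal_ofReal
  have hpoint : ∀ ω, payoff p W S 0 t (v ω) ω + (k + β) ≤
      S * (unitStock p W t (v ω) ω + unitDiv p W t (v ω) ω) + β * Z ω := by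
    intro ω
    have h := max_sub_add_le (b := W (v ω) ω - W t ω) hkpos hc hδ hσ
      (sub_le_sub_right (by exact_mod_cast (hv.2 ω).2 : (v ω : ℝ) ≤ T) (t : ℝ))
    have hkk : p.K * Real.exp (p.γ * v ω - p.r * ((v ω : ℝ) - t)) =
        k * Real.exp ((p.γ - p.r) * ((v ω : ℝ) - t)) := by
      rw [hk, mul_assoc, ← Real.exp_add]
      ring_nf
    rw [payoff_eq p W S (hv.2 ω).1, hkk]
    simp only [unitStock, expMart, hZ]
    linarith
  calc ∫⁻ ω, ENNReal.ofReal (payoff p W S 0 t (v ω) ω) ∂P + ENNReal.ofReal (k + β)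
      = ∫⁻ ω, (ENNReal.ofReal (payoff p W S 0 t (v ω) ω) + ENNReal.ofReal (k + β)) ∂P := by
        rw [lintegral_add_right _ measurable_const]
        simp
    _ ≤ ∫⁻ ω, (ENNReal.ofReal S *
          ENNReal.ofReal (unitStock p W t (v ω) ω + unitDiv p W t (v ω) ω) +
          ENNReal.ofReal β * ENNReal.ofReal (Z ω)) ∂P := by
        refine lintegral_mono fun ω => ?_
        rw [← ENNReal.ofReal_mul hSpos.le, ← ENNReal.ofReal_mul hβpos.le,
          ← ENNReal.ofReal_add (payoff_nonneg hδ (hv.2 ω).1 hSpos.le ω) (by positivity),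
          ← ENNReal.ofReal_add (mul_nonneg hSpos.le (hA0 ω)) (mul_nonneg hβpos.le (hZ0 ω))]
        exact ENNReal.ofReal_le_ofReal (hpoint ω)
    _ = ENNReal.ofReal S *
          ∫⁻ ω, ENNReal.ofReal (unitStock p W t (v ω) ω + unitDiv p W t (v ω) ω) ∂P +
          ENNReal.ofReal β * ∫⁻ ω, ENNReal.ofReal (Z ω) ∂P := by
        rw [lintegral_add_right _ (hZm.const_mul _), lintegral_const_mul _ hZm,
          lintegral_const_mul' _ _ ENNReal.ofReal_ne_top]
    _ ≤ ENNReal.ofReal S * 1 + ENNReal.ofReal β * 1 := by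
        gcongr
        · exact hW.lintegral_unitStock_add_unitDiv_le p hδ htT hv
        · exact hW.lintegral_cosh_le htT hv
    _ = ENNReal.ofReal (S + β) := by
        rw [mul_one, mul_one, ENNReal.ofReal_add hSpos.le hβpos.le]

/-- Immediate redemption gives one inequality for free, and `H ≥ 0` forces the price to be at least
the balance. -/
lemma HasExpMart.mem_E3_iff [IsProbabilityMeasure P] (hW : HasExpMart W ℱ P) (hδ : 0 ≤ p.δ)
    (hK : 0 < p.K) {S : ℝ} :
    (S, t) ∈ E3 p ℱ W P T ↔
      p.K * Real.exp (p.γ * t) ≤ S ∧ t < T ∧ H p ℱ W P T S t ≤ S - p.K * Real.exp (p.γ * t) := by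
  have hk : 0 < p.K * Real.exp (p.γ * t) := by positivity
  constructor
  · rintro ⟨⟨_, htT⟩, h : H p ℱ W P T S t = S - p.K * Real.exp (p.γ * t)⟩
    exact ⟨sub_nonneg.1 (h ▸ H_nonneg S), htT, h.le⟩
  · rintro ⟨hS, htT, h⟩
    have hS0 := hk.trans_le hS
    exact ⟨⟨hS0, htT⟩, h.antisymm (hW.sub_le_H hδ hK.le (le_of_lt htT) hS0.le)⟩

/-! ### The redemption boundary -/

section Boundary

variable [IsProbabilityMeasure P]

/-- The Lipschitz bound says that `H - S` does not increase with `S`. -/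
lemma HasExpMart.mem_E3_of_le (hW : HasExpMart W ℱ P) (hδ : 0 ≤ p.δ) (hK : 0 < p.K) {S S' : ℝ}
    (h : S ≤ S') (hS : (S, t) ∈ E3 p ℱ W P T) : (S', t) ∈ E3 p ℱ W P T := by
  rw [hW.mem_E3_iff hδ hK] at hS ⊢
  obtain ⟨h1, htT, h2⟩ := hS
  have hk : 0 < p.K * Real.exp (p.γ * t) := by positivity
  refine ⟨h1.trans h, htT, ?_⟩
  linarith [hW.H_le_add hδ hK.le htT.le (hk.le.trans h1) h]

lemma HasExpMart.bddBelow_section (hW : HasExpMart W ℱ P) (hδ : 0 ≤ p.δ) (hK : 0 < p.K) :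
    p.K * Real.exp (p.γ * t) ∈ lowerBounds {S : ℝ | (S, t) ∈ E3 p ℱ W P T} :=
  fun _ hS => ((hW.mem_E3_iff hδ hK).1 hS).1

/-- Without this, `sInf` would take its default value `0` and carry no information. -/
lemma HasExpMart.section_nonempty (hW : HasExpMart W ℱ P) (hδ : 0 ≤ p.δ) (hσ : 0 < p.σ)
    (hK : 0 < p.K) (hγ : p.r < p.γ) (htT : t < T) :
    {S : ℝ | (S, t) ∈ E3 p ℱ W P T}.Nonempty := by
  obtain ⟨S, hS, h⟩ := hW.exists_H_le_sub hδ hσ hK hγ htT.le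
  exact ⟨S, (hW.mem_E3_iff hδ hK).2 ⟨sub_nonneg.1 ((H_nonneg S).trans h), htT, h⟩⟩

lemma HasExpMart.le_S3star (hW : HasExpMart W ℱ P) (hδ : 0 ≤ p.δ) (hσ : 0 < p.σ)
    (hK : 0 < p.K) (hγ : p.r < p.γ) (htT : t < T) :
    p.K * Real.exp (p.γ * t) ≤ S3star p ℱ W P T t :=
  le_csInf (hW.section_nonempty hδ hσ hK hγ htT) (hW.bddBelow_section hδ hK)

/-- A price in the section within `ε` of the infimum bounds `H` there by monotonicity; let `ε` tend
to zero. -/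
lemma HasExpMart.S3star_mem_E3 (hW : HasExpMart W ℱ P) (hδ : 0 ≤ p.δ) (hσ : 0 < p.σ)
    (hK : 0 < p.K) (hγ : p.r < p.γ) (htT : t < T) :
    (S3star p ℱ W P T t, t) ∈ E3 p ℱ W P T := by
  have hk : 0 < p.K * Real.exp (p.γ * t) := by positivity
  have hle := hW.le_S3star hδ hσ hK hγ htT
  refine (hW.mem_E3_iff hδ hK).2 ⟨hle, htT, le_of_forall_pos_lt_add fun ε hε => ?_⟩
  obtain ⟨S, hS, hlt⟩ := exists_lt_of_csInf_lt (hW.section_nonempty hδ hσ hK hγ htT)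
    (lt_add_of_pos_right (S3star p ℱ W P T t) hε)
  have h1 : S3star p ℱ W P T t ≤ S := csInf_le ⟨_, hW.bddBelow_section hδ hK⟩ hS
  have h2 := ((hW.mem_E3_iff hδ hK).1 hS).2.2
  linarith [hW.H_mono hδ hK.le htT.le (hk.le.trans hle) h1]

lemma HasExpMart.E3_eq (hW : HasExpMart W ℱ P) (hδ : 0 ≤ p.δ) (hσ : 0 < p.σ)
    (hK : 0 < p.K) (hγ : p.r < p.γ) :
    E3 p ℱ W P T = {q ∈ Q T | S3star p ℱ W P T q.2 ≤ q.1} := by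
  ext ⟨S, t⟩
  constructor
  · intro h
    exact ⟨h.1, csInf_le ⟨_, hW.bddBelow_section hδ hK⟩ h⟩
  · rintro ⟨⟨_, htT⟩, h⟩
    exact hW.mem_E3_of_le hδ hK h (hW.S3star_mem_E3 hδ hσ hK hγ htT)

lemma HasExpMart.tendsto_S3star (hW : HasExpMart W ℱ P) (hδ : 0 < p.δ) (hσ : 0 < p.σ)
    (hK : 0 < p.K) (hγ : p.r < p.γ) (t : ℝ≥0) :
    Tendsto (fun T : ℝ≥0 => S3star p ℱ W P T t) atTop atTop := by
  have hk : 0 < p.K * Real.exp (p.γ * t) := by positivity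
  refine tendsto_atTop.2 fun b => ?_
  have hS : 0 < max b 1 := one_pos.trans_le (le_max_right _ _)
  -- Once `H` exceeds `S - K e^{γt}` at `S = max b 1`, that price is outside the section, and upward
  -- closure excludes everything below it. The `1` only keeps the price positive.
  filter_upwards [(hW.tendsto_H hδ hK.le hS.le t).eventually_const_lt (sub_lt_self _ hk),
    eventually_gt_atTop t] with T hT htT
  refine le_csInf (hW.section_nonempty hδ.le hσ hK hγ htT) fun S hmem => ?_
  by_contra! hlt
  have := hW.mem_E3_of_le hδ.le hK (hlt.le.trans (le_max_left b 1)) hmem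
  exact absurd ((hW.mem_E3_iff hδ.le hK).1 this).2.2 (not_le.2 hT)

end Boundary

end StockLoan

theorem proposition4p3 {Ω : Type*} {mΩ : MeasurableSpace Ω} (P : Measure Ω)
    [IsProbabilityMeasure P] (ℱ : Filtration ℝ≥0 mΩ) (W : ℝ≥0 → Ω → ℝ)
    (hW : IsFilteredBrownian W ℱ P) (p : Params)
    (hr : 0 < p.r) (hδ : 0 < p.δ) (hσ : 0 < p.σ) (hK : 0 < p.K) :
    (∀ S : ℝ, 0 < S → ∀ t : ℝ≥0, Tendsto (fun T : ℝ≥0 => H p ℱ W P T S t) atTop (𝓝 S)) ∧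
    (p.r < p.γ →
      (∀ T : ℝ≥0, 0 < T →
        (∀ t < T, 0 < S3star p ℱ W P T t) ∧
        E3 p ℱ W P T = {q ∈ Q T | S3star p ℱ W P T q.2 ≤ q.1}) ∧
      ∀ t : ℝ≥0, Tendsto (fun T : ℝ≥0 => S3star p ℱ W P T t) atTop atTop) := by
  obtain ⟨W', hW', hae⟩ := hW.exists_hasExpMart
  have hH := H_congr p ℱ hae
  have hE : E3 p ℱ W P = E3 p ℱ W' P := by
    unfold E3
    rw [hH]
  have hstar : S3star p ℱ W P = S3star p ℱ W' P := by
    unfold S3star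
    rw [hE]
  rw [hH, hE, hstar]
  exact ⟨fun S hS t => hW'.tendsto_H hδ hK.le hS.le t, fun hγ =>
    ⟨fun T _ => ⟨fun t htT => (by positivity : 0 < p.K * Real.exp (p.γ * t)).trans_le
      (hW'.le_S3star hδ.le hσ hK hγ htT), hW'.E3_eq hδ.le hσ hK hγ⟩,
    fun t => hW'.tendsto_S3star hδ hσ hK hγ t⟩⟩
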